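/- Let $\mathcal A=(\mathcal P,\mathcal L)$ be an affine plane (two distinct points lie on exactly one line; Playfair's axiom; there are three non-collinear points) satisfying Desargues' axiom. Two lines are called parallel if they are equal or disjoint. For points $O\ne I$, let $(\ell^{OI},+,\cdot)$ be the line through $O$ and $I$ with the following geometric operations. For $A,B\in\ell^{OI}$ choose a point $B_1\notin\ell^{OI}$. * Sum: let $P_1$ be the intersection of the parallel to $\ell^{OI}$ through $B_1$ with the parallel to $\ell^{OB_1}$ through $A$. Then $A+B$ is the intersection of $\ell^{OI}$ with the parallel to $\ell^{BB_1}$ through $P_1$. * Product: let $P_1$ be the intersection of the parallel to $\ell^{IB_1}$ through $A$ with $\ell^{OB_1}$. Then $A\cdot B$ is the intersection of $\ell^{OI}$ with the parallel to $\ell^{BB_1}$ through $P_1$. For $A,B,C,D\in\ell^{OI}$, no three of them equal, put $$c_r(A,B;C,D)=\left[(A-D)^{-1}(B-D)\right]\left[(B-C)^{-1}(A-C)\right],$$ computed in $(\ell^{OI},+,\cdot)$ with the convention that the value is $\infty$ if $A=D$ or $B=C$. If exactly one of the arguments is a point $\infty$ added to the line (and the other three are not all equal), put $$c_r(\infty,B;C,D)=(B-D)(B-C)^{-1},\qquad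 c_r(A,\infty;C,D)=(A-D)^{-1}(A-C),$$ $$c_r(A,B;\infty,D)=(A-D)^{-1}(B-D),\qquad c_r(A,B;C,\infty)=(B-C)^{-1}(A-C),$$ again with value $\infty$ if the element to be inverted is zero. A translation is a map $\varphi:\mathcal P\to\mathcal P$ that is either the identity or a bijection without fixed points that maps every line to a line parallel to it. **Theorem.** Let $\varphi$ be a translation of $\mathcal A$, let $O\neq I$ be points, and put $O'=\varphi(O)$, $I'=\varphi(I)$. Then $\varphi(\ell^{OI})=\ell^{O'I'}$, and this line is equal or parallel to $\ell^{OI}$. The operations above do not depend on the choice of $B_1$ and make $\ell^{OI}$ a skew field with zero $O$ and unit $I$, and likewise $\ell^{O'I'}$ a skew field with zero $O'$ and unit $I'$. The restriction of $\varphi$ is an isomorphism of skew fields $(\ell^{OI},+,\cdot)\to(\ell^{O'I'},+,\cdot)$. With $\varphi(\infty)=\infty$, for all $A,B,C,D\in\ell^{OI}\cup\{\infty\}$, no three of them equal and at most one of them $\infty$, $$\varphi\bigl(c_r(A,B;C,D)\bigr)=c_r\bigl(\varphi(A),\varphi(B);\varphi(C),\varphi(D)\bigr),$$ where the left cross-ratio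 is computed in $(\ell^{OI},+,\cdot)$ and the right one in $(\ell^{O'I'},+,\cdot)$. -/

import Mathlib

/-- An affine plane with point set `P`: lines are sets of points, two distinct points lie on
exactly one line, Playfair's axiom holds, and there are three non-collinear points. -/
structure AffinePlane (P : Type*) where
  lines : Set (Set P)
  existsUnique_line : ∀ p q : P, p ≠ q → ∃! l : Set P, l ∈ lines ∧ p ∈ l ∧ q ∈ l
  existsUnique_parallel : ∀ (p : P) (l : Set P), l ∈ lines → p ∉ l →
    ∃! m : Set P, m ∈ lines ∧ p ∈ m ∧ l ∩ m = ∅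
  exists_noncollinear : ∃ p q r : P, p ≠ q ∧ q ≠ r ∧ p ≠ r ∧
    ∀ l ∈ lines, ¬ (p ∈ l ∧ q ∈ l ∧ r ∈ l)

namespace AffinePlane

variable {P : Type*}

/-- Two lines are parallel if they are equal or have no common point. -/
def Parallel (l m : Set P) : Prop := l = m ∨ l ∩ m = ∅

/-- The line joining two distinct points `p`, `q` (see `line_eq`; only used for `p ≠ q`). -/
def line (𝒜 : AffinePlane P) (p q : P) : Set P :=
  {x | ∃ l ∈ 𝒜.lines, p ∈ l ∧ q ∈ l ∧ x ∈ l}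

/-- The line through the point `r` that is parallel to the line `l` (see `parallelThrough_eq`). -/
def parallelThrough (𝒜 : AffinePlane P) (l : Set P) (r : P) : Set P :=
  {x | ∃ m ∈ 𝒜.lines, r ∈ m ∧ Parallel l m ∧ x ∈ m}

theorem line_eq (𝒜 : AffinePlane P) {p q : P} (h : p ≠ q) {l : Set P} (hl : l ∈ 𝒜.lines)
    (hp : p ∈ l) (hq : q ∈ l) : 𝒜.line p q = l := by
  ext x
  constructor
  · rintro ⟨m, hm, hpm, hqm, hx⟩
    rwa [(𝒜.existsUnique_line p q h).unique ⟨hl, hp, hq⟩ ⟨hm, hpm, hqm⟩]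
  · exact fun hx => ⟨l, hl, hp, hq, hx⟩

theorem line_mem (𝒜 : AffinePlane P) {p q : P} (h : p ≠ q) :
    𝒜.line p q ∈ 𝒜.lines ∧ p ∈ 𝒜.line p q ∧ q ∈ 𝒜.line p q := by
  obtain ⟨l, ⟨hl, hp, hq⟩, -⟩ := 𝒜.existsUnique_line p q h
  rw [𝒜.line_eq h hl hp hq]
  exact ⟨hl, hp, hq⟩

theorem parallelThrough_eq (𝒜 : AffinePlane P) {l m : Set P} {r : P} (hl : l ∈ 𝒜.lines)
    (hm : m ∈ 𝒜.lines) (hr : r ∈ m) (hlm : Parallel l m) : 𝒜.parallelThrough l r = m := by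
  have key : ∀ n ∈ 𝒜.lines, r ∈ n → Parallel l n → n = m := by
    intro n hn hrn hln
    by_cases hrl : r ∈ l
    · have aux : ∀ k : Set P, r ∈ k → Parallel l k → k = l := by
        rintro k hk (h | h)
        · exact h.symm
        · exact absurd (show r ∈ l ∩ k from ⟨hrl, hk⟩) (by simp [h])
      rw [aux n hrn hln, aux m hr hlm]
    · have aux : ∀ k : Set P, r ∈ k → Parallel l k → l ∩ k = ∅ := by
        rintro k hk (h | h)
        · exact absurd (h ▸ hk) hrl
        · exact h
      exact (𝒜.existsUnique_parallel r l hl hrl).unique ⟨hn, hrn, aux n hrn hln⟩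
        ⟨hm, hr, aux m hr hlm⟩
  ext x
  constructor
  · rintro ⟨n, hn, hrn, hln, hx⟩
    rwa [← key n hn hrn hln]
  · exact fun hx => ⟨m, hm, hr, hlm, hx⟩

theorem parallelThrough_mem (𝒜 : AffinePlane P) {l : Set P} (hl : l ∈ 𝒜.lines) (r : P) :
    𝒜.parallelThrough l r ∈ 𝒜.lines ∧ r ∈ 𝒜.parallelThrough l r ∧
      Parallel l (𝒜.parallelThrough l r) := by
  have : ∃ m ∈ 𝒜.lines, r ∈ m ∧ Parallel l m := by
    by_cases h : r ∈ l
    · exact ⟨l, hl, h, Or.inl rfl⟩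
    · obtain ⟨m, ⟨hm, hr, hlm⟩, -⟩ := 𝒜.existsUnique_parallel r l hl h
      exact ⟨m, hm, hr, Or.inr hlm⟩
  obtain ⟨m, hm, hr, hlm⟩ := this
  rw [𝒜.parallelThrough_eq hl hm hr hlm]
  exact ⟨hm, hr, hlm⟩

/-- Desargues' axiom: for triangles `A B C` and `A' B' C'` whose vertices are joined by three
distinct lines `AA'`, `BB'`, `CC'` that are all parallel or have a common point, `AB ∥ A'B'` and
`BC ∥ B'C'` imply `AC ∥ A'C'`. -/
def IsDesarguesian (𝒜 : AffinePlane P) : Prop :=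
  ∀ A B C A' B' C' : P, A ≠ A' → B ≠ B' → C ≠ C' →
    A ≠ B → B ≠ C → A ≠ C → A' ≠ B' → B' ≠ C' → A' ≠ C' →
    𝒜.line A A' ≠ 𝒜.line B B' → 𝒜.line B B' ≠ 𝒜.line C C' → 𝒜.line A A' ≠ 𝒜.line C C' →
    ((Parallel (𝒜.line A A') (𝒜.line B B') ∧ Parallel (𝒜.line B B') (𝒜.line C C') ∧
        Parallel (𝒜.line A A') (𝒜.line C C')) ∨
      ∃ S : P, S ∈ 𝒜.line A A' ∧ S ∈ 𝒜.line B B' ∧ S ∈ 𝒜.line C C') →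
    Parallel (𝒜.line A B) (𝒜.line A' B') → Parallel (𝒜.line B C) (𝒜.line B' C') →
    Parallel (𝒜.line A C) (𝒜.line A' C')

/-- A collineation: a bijection of the points that maps lines to lines. -/
def IsCollineation (𝒜 : AffinePlane P) (φ : P → P) : Prop :=
  Function.Bijective φ ∧ ∀ l ∈ 𝒜.lines, φ '' l ∈ 𝒜.lines

/-- A dilatation: a collineation that maps every line to a parallel line. -/
def IsDilatation (𝒜 : AffinePlane P) (φ : P → P) : Prop :=
  𝒜.IsCollineation φ ∧ ∀ p q : P, p ≠ q → Parallel (φ '' 𝒜.line p q) (𝒜.line p q)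

/-- A translation: the identity, or a dilatation without fixed points. -/
def IsTranslation (𝒜 : AffinePlane P) (φ : P → P) : Prop :=
  φ = id ∨ (𝒜.IsDilatation φ ∧ ∀ p : P, φ p ≠ p)

/-- `C` is the point produced by the addition algorithm from the points `A`, `B` of the line `OI`
with the auxiliary point `B₁` off that line: `P₁` is the intersection of the parallel to `OI`
through `B₁` with the parallel to `OB₁` through `A`, and `C` is the intersection of the parallel
to `BB₁` through `P₁` with `OI`. -/
def AddConstruction (𝒜 : AffinePlane P) (O I A B B₁ C : P) : Prop :=
  ∃ P₁ : P,
    𝒜.parallelThrough (𝒜.line O I) B₁ ∩ 𝒜.parallelThrough (𝒜.line O B₁) A = {P₁} ∧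
    𝒜.parallelThrough (𝒜.line B B₁) P₁ ∩ 𝒜.line O I = {C}

/-- `C` is the point produced by the multiplication algorithm from the points `A`, `B` of the line
`OI` with the auxiliary point `B₁` off that line: `P₁` is the intersection of the parallel to `IB₁`
through `A` with `OB₁`, and `C` is the intersection of the parallel to `BB₁` through `P₁`
with `OI`. -/
def MulConstruction (𝒜 : AffinePlane P) (O I A B B₁ C : P) : Prop :=
  ∃ P₁ : P,
    𝒜.parallelThrough (𝒜.line I B₁) A ∩ 𝒜.line O B₁ = {P₁} ∧
    𝒜.parallelThrough (𝒜.line B B₁) P₁ ∩ 𝒜.line O I = {C}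

/-- `K` is the skew field `(ℓ^{OI}, +, ·)` of the line `OI`: its zero is `O`, its unit is `I`, and
for every choice of the auxiliary point off the line, the addition and multiplication algorithms
produce its sums and products. This determines `K`. -/
def IsLineSkewField (𝒜 : AffinePlane P) (O I : P) (K : DivisionRing (𝒜.line O I)) : Prop :=
  ((0 : 𝒜.line O I) : P) = O ∧ ((1 : 𝒜.line O I) : P) = I ∧
    ∀ A B : 𝒜.line O I, ∀ B₁ : P, B₁ ∉ 𝒜.line O I →
      𝒜.AddConstruction O I A B B₁ (A + B : 𝒜.line O I) ∧
      𝒜.MulConstruction O I A B B₁ (A * B : 𝒜.line O I)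

end AffinePlane

open Classical in
/-- The cross-ratio `c_r(A,B;C,D)` over a skew field with a point `∞` added, where `0⁻¹ = ∞`.
Only used where `CrossRatioDefined A B C D` holds; the last line is a default value. -/
noncomputable def crossRatio {K : Type*} [DivisionRing K] :
    OnePoint K → OnePoint K → OnePoint K → OnePoint K → OnePoint K
  | .some a, .some b, .some c, .some d =>
      if a = d ∨ b = c then .infty
      else .some (((a - d)⁻¹ * (b - d)) * ((b - c)⁻¹ * (a - c)))
  | .infty, .some b, .some c, .some d =>
      if b = c then .infty else .some ((b - d) * (b - c)⁻¹)
  | .some a, .infty, .some c, .some d =>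
      if a = d then .infty else .some ((a - d)⁻¹ * (a - c))
  | .some a, .some b, .infty, .some d =>
      if a = d then .infty else .some ((a - d)⁻¹ * (b - d))
  | .some a, .some b, .some c, .infty =>
      if b = c then .infty else .some ((b - c)⁻¹ * (a - c))
  | _, _, _, _ => .infty

/-- The quadruples that have a cross-ratio: no three of the points are equal, and at most one of
them is `∞`. -/
def CrossRatioDefined {K : Type*} (A B C D : OnePoint K) : Prop :=
  ¬ (A = B ∧ B = C) ∧ ¬ (A = B ∧ B = D) ∧ ¬ (A = C ∧ C = D) ∧ ¬ (B = C ∧ C = D) ∧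
    ¬ (A = .infty ∧ B = .infty) ∧ ¬ (A = .infty ∧ C = .infty) ∧ ¬ (A = .infty ∧ D = .infty) ∧
    ¬ (B = .infty ∧ C = .infty) ∧ ¬ (B = .infty ∧ D = .infty) ∧ ¬ (C = .infty ∧ D = .infty)

/-! Call a map homothetic if it sends every segment to a parallel one, constant maps included. Such
a map is determined by two values, and a shift (the identity, or a homothetic map without fixed
points) by one. Desargues' axiom supplies enough of them: a shift taking any point to any other, and
a homothetic map fixing `O` and taking `I` to any point of the line `OI`.

On that line `A + B` is the image of `B` under the shift with `O ↦ A`, and `A * B` its image under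
the homothetic map with `O ↦ O`, `I ↦ A`. The ring laws become identities between maps;
distributivity rests on `IsHomothetic.map_shift` and `IsHomothetic.shift`. These maps carry the
auxiliary point `B₁` to the point `P₁` of the algorithms, so the algorithms compute exactly these
operations for every `B₁`.

A translation `φ` is itself homothetic and injective. It therefore carries shifts to shifts and
homothetic maps about `O` to homothetic maps about `φ O`, so it is an isomorphism of skew fields.
Cross-ratios follow because they are built from the field operations. -/

namespace AffinePlane

variable {P : Type*}

/-! ### Parallelism and directions -/

theorem Parallel.symm {l m : Set P} (h : Parallel l m) : Parallel m l := by
  rcases h with h | h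
  · exact Or.inl h.symm
  · exact Or.inr (by rwa [Set.inter_comm])

theorem Parallel.trans (𝒜 : AffinePlane P) {l m n : Set P} (hl : l ∈ 𝒜.lines)
    (hm : m ∈ 𝒜.lines) (hn : n ∈ 𝒜.lines) (h : Parallel l m) (h' : Parallel m n) :
    Parallel l n := by
  by_cases hx : l ∩ n = ∅
  · exact Or.inr hx
  · obtain ⟨x, hxl, hxn⟩ := Set.nonempty_iff_ne_empty.2 hx
    left
    rw [← 𝒜.parallelThrough_eq hm hl hxl h.symm, ← 𝒜.parallelThrough_eq hm hn hxn h']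

theorem exists_ne_point (𝒜 : AffinePlane P) (p : P) : ∃ q, p ≠ q := by
  obtain ⟨a, b, -, hab, -⟩ := 𝒜.exists_noncollinear
  by_cases h : p = a
  · exact ⟨b, h ▸ hab⟩
  · exact ⟨a, h⟩

theorem exists_line (𝒜 : AffinePlane P) (p q : P) : ∃ l ∈ 𝒜.lines, p ∈ l ∧ q ∈ l := by
  by_cases h : p = q
  · obtain ⟨r, hr⟩ := 𝒜.exists_ne_point p
    exact ⟨_, (𝒜.line_mem hr).1, (𝒜.line_mem hr).2.1, h ▸ (𝒜.line_mem hr).2.1⟩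
  · exact ⟨_, 𝒜.line_mem h⟩

/-- The pairs `p q` and `r s` lie on parallel lines. This always holds if `p = q` or `r = s`. -/
def SegParallel (𝒜 : AffinePlane P) (p q r s : P) : Prop :=
  ∃ l ∈ 𝒜.lines, ∃ m ∈ 𝒜.lines, Parallel l m ∧ p ∈ l ∧ q ∈ l ∧ r ∈ m ∧ s ∈ m

/-- The lines parallel to the line joining `p` and `q`. -/
def direction (𝒜 : AffinePlane P) (p q : P) : Set (Set P) :=
  {l | l ∈ 𝒜.lines ∧ Parallel l (𝒜.line p q)}

variable {𝒜 : AffinePlane P} {p q r s t u a b x y : P}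

theorem line_comm (p q : P) : 𝒜.line p q = 𝒜.line q p := by
  ext x
  simp only [line, Set.mem_ofPred_eq]
  tauto

theorem direction_comm (p q : P) : 𝒜.direction p q = 𝒜.direction q p := by
  rw [direction, direction, line_comm]

theorem direction_eq_iff (h : p ≠ q) (h' : r ≠ s) :
    𝒜.direction p q = 𝒜.direction r s ↔ Parallel (𝒜.line p q) (𝒜.line r s) := by
  have h1 := (𝒜.line_mem h).1
  have h2 := (𝒜.line_mem h').1
  constructor
  · intro e
    have : 𝒜.line p q ∈ 𝒜.direction p q := ⟨h1, Or.inl rfl⟩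
    rw [e] at this
    exact this.2
  · intro e
    ext l
    exact ⟨fun hl => ⟨hl.1, Parallel.trans 𝒜 hl.1 h1 h2 hl.2 e⟩,
      fun hl => ⟨hl.1, Parallel.trans 𝒜 hl.1 h2 h1 hl.2 e.symm⟩⟩

theorem parallel_line_iff (h : p ≠ q) (h' : r ≠ s) :
    Parallel (𝒜.line p q) (𝒜.line r s) ↔ 𝒜.SegParallel p q r s := by
  constructor
  · intro e
    have h1 := 𝒜.line_mem h
    have h2 := 𝒜.line_mem h'
    exact ⟨_, h1.1, _, h2.1, e, h1.2.1, h1.2.2, h2.2.1, h2.2.2⟩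
  · rintro ⟨l, hl, m, hm, hlm, hp, hq, hr, hs⟩
    rwa [𝒜.line_eq h hl hp hq, 𝒜.line_eq h' hm hr hs]

theorem SegParallel.symm (h : 𝒜.SegParallel p q r s) : 𝒜.SegParallel r s p q := by
  obtain ⟨l, hl, m, hm, hlm, hp, hq, hr, hs⟩ := h
  exact ⟨m, hm, l, hl, hlm.symm, hr, hs, hp, hq⟩

theorem segParallel_self_left (p r s : P) : 𝒜.SegParallel p p r s := by
  obtain ⟨m, hm, hr, hs⟩ := 𝒜.exists_line r s
  have h := 𝒜.parallelThrough_mem hm p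
  exact ⟨_, h.1, m, hm, h.2.2.symm, h.2.1, h.2.1, hr, hs⟩

/-- Away from degenerate segments, parallelism becomes equality of directions, so its transitivity
comes for free. -/
theorem segParallel_iff :
    𝒜.SegParallel p q r s ↔ p = q ∨ r = s ∨ 𝒜.direction p q = 𝒜.direction r s := by
  by_cases h : p = q
  · subst h; simpa using segParallel_self_left _ _ _
  by_cases h' : r = s
  · subst h'; simpa using (segParallel_self_left _ _ _).symm
  simp [h, h', direction_eq_iff h h', parallel_line_iff h h']

theorem mem_line_iff (h : p ≠ q) : x ∈ 𝒜.line p q ↔ 𝒜.SegParallel p q p x := by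
  have h1 := 𝒜.line_mem h
  constructor
  · intro hx
    exact ⟨_, h1.1, _, h1.1, Or.inl rfl, h1.2.1, h1.2.2, h1.2.1, hx⟩
  · rintro ⟨l, hl, m, hm, hlm, hp, hq, hr, hs⟩
    rcases hlm with rfl | hlm
    · rwa [𝒜.line_eq h hl hp hq]
    · exact absurd (show p ∈ l ∩ m from ⟨hp, hr⟩) (by simp [hlm])

theorem mem_parallelThrough_iff (h : p ≠ q) :
    x ∈ 𝒜.parallelThrough (𝒜.line p q) r ↔ 𝒜.SegParallel p q r x := by
  have h1 := 𝒜.line_mem h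
  constructor
  · rintro ⟨m, hm, hr, hlm, hx⟩
    exact ⟨_, h1.1, m, hm, hlm, h1.2.1, h1.2.2, hr, hx⟩
  · rintro ⟨l, hl, m, hm, hlm, hp, hq, hr, hs⟩
    rw [𝒜.line_eq h hl hp hq]
    exact ⟨m, hm, hr, hlm, hs⟩

theorem direction_join (p q r : P) : p = q ∨ q = r ∨ p = r ∨
    𝒜.direction p q ≠ 𝒜.direction p r ∨ 𝒜.direction p q = 𝒜.direction q r := by
  by_contra! H
  obtain ⟨hp, hqr, -, h, h'⟩ := H
  have h1 : r ∈ 𝒜.line p q := (mem_line_iff hp).2 (segParallel_iff.2 (Or.inr (Or.inr h)))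
  have h2 := 𝒜.line_mem hp
  rw [ne_eq, direction_eq_iff hp hqr] at h'
  exact h' (Or.inl (𝒜.line_eq hqr h2.1 h2.2.2 h1).symm)

theorem exists_segParallel_inter (h : ¬ 𝒜.SegParallel p q r s) (a b : P) :
    ∃ x, 𝒜.SegParallel p q a x ∧ 𝒜.SegParallel r s b x := by
  have hpq : p ≠ q := fun e => h (segParallel_iff.2 (Or.inl e))
  have hrs : r ≠ s := fun e => h (segParallel_iff.2 (Or.inr (Or.inl e)))
  have h1 := (𝒜.line_mem hpq).1
  have h2 := (𝒜.line_mem hrs).1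
  have h3 := 𝒜.parallelThrough_mem h1 a
  have h4 := 𝒜.parallelThrough_mem h2 b
  rw [← parallel_line_iff hpq hrs] at h
  have : 𝒜.parallelThrough (𝒜.line p q) a ∩ 𝒜.parallelThrough (𝒜.line r s) b ≠ ∅ := by
    intro e
    exact h (Parallel.trans 𝒜 h1 h3.1 h2 h3.2.2
      (Parallel.trans 𝒜 h3.1 h4.1 h2 (Or.inr e) h4.2.2.symm))
  obtain ⟨x, hx, hx'⟩ := Set.nonempty_iff_ne_empty.2 this
  exact ⟨x, (mem_parallelThrough_iff hpq).1 hx, (mem_parallelThrough_iff hrs).1 hx'⟩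

theorem SegParallel.inter_unique (h : ¬ 𝒜.SegParallel p q r s) (h1 : 𝒜.SegParallel p q a x)
    (h2 : 𝒜.SegParallel p q a y) (h3 : 𝒜.SegParallel r s b x) (h4 : 𝒜.SegParallel r s b y) :
    x = y := by
  simp only [segParallel_iff] at *
  grind -ext [direction_comm, direction_join]

theorem exists_not_collinear (𝒜 : AffinePlane P) (p q : P) (h : p ≠ q) :
    ∃ r, ¬ 𝒜.SegParallel p q p r := by
  obtain ⟨a, b, c, hab, hbc, hac, hl⟩ := 𝒜.exists_noncollinear
  by_contra! H
  exact hl _ (𝒜.line_mem h).1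
    ⟨(mem_line_iff h).2 (H a), (mem_line_iff h).2 (H b), (mem_line_iff h).2 (H c)⟩

theorem IsDesarguesian.segParallel (h𝒜 : 𝒜.IsDesarguesian) {A B C A' B' C' : P}
    (hA : A ≠ A') (hB : B ≠ B') (hC : C ≠ C') (hAB : A ≠ B) (hBC : B ≠ C) (hAC : A ≠ C)
    (hAB' : A' ≠ B') (hBC' : B' ≠ C') (hAC' : A' ≠ C')
    (h1 : B ∉ 𝒜.line A A') (h2 : C ∉ 𝒜.line B B') (h3 : C ∉ 𝒜.line A A')
    (h : (𝒜.SegParallel A A' B B' ∧ 𝒜.SegParallel B B' C C' ∧ 𝒜.SegParallel A A' C C') ∨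
      ∃ S, 𝒜.SegParallel A A' A S ∧ 𝒜.SegParallel B B' B S ∧ 𝒜.SegParallel C C' C S)
    (hp : 𝒜.SegParallel A B A' B') (hq : 𝒜.SegParallel B C B' C') :
    𝒜.SegParallel A C A' C' := by
  rw [← parallel_line_iff hAC hAC']
  refine h𝒜 A B C A' B' C' hA hB hC hAB hBC hAC hAB' hBC' hAC' ?_ ?_ ?_ ?_
    ((parallel_line_iff hAB hAB').2 hp) ((parallel_line_iff hBC hBC').2 hq)
  · exact fun e => h1 (e ▸ (𝒜.line_mem hB).2.1)
  · exact fun e => h2 (e ▸ (𝒜.line_mem hC).2.1)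
  · exact fun e => h3 (e ▸ (𝒜.line_mem hC).2.1)
  · simpa only [parallel_line_iff hA hB, parallel_line_iff hB hC, parallel_line_iff hA hC,
      mem_line_iff hA, mem_line_iff hB, mem_line_iff hC] using h

/-! ### Homothetic maps and shifts -/

variable {P : Type*} {𝒜 : AffinePlane P} {p q r s t u a b x y : P}

theorem SegParallel.trans (h : 𝒜.SegParallel p q r s) (h' : 𝒜.SegParallel r s t u)
    (hrs : r ≠ s) : 𝒜.SegParallel p q t u := by
  simp only [segParallel_iff] at *
  grind -ext

/-- A map of the points that maps every line into a parallel line; it may be constant. -/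
def IsHomothetic (𝒜 : AffinePlane P) (σ : P → P) : Prop :=
  ∀ p q, 𝒜.SegParallel p q (σ p) (σ q)

theorem isHomothetic_id : 𝒜.IsHomothetic id := fun p q => by simp [segParallel_iff]

theorem isHomothetic_const (c : P) : 𝒜.IsHomothetic fun _ => c :=
  fun p q => by simp [segParallel_iff]

theorem IsHomothetic.comp {σ τ : P → P} (hσ : 𝒜.IsHomothetic σ) (hτ : 𝒜.IsHomothetic τ) :
    𝒜.IsHomothetic (σ ∘ τ) := by
  intro p q
  by_cases h : τ p = τ q
  · simp [segParallel_iff, h]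
  · exact (hτ p q).trans (hσ _ _) h

/-- The image of `r` is the only common point of the parallels to `p r` and `q r` through the images
of `p` and `q`. -/
theorem IsHomothetic.eq_of_eq_of_not_collinear {σ τ : P → P} (hσ : 𝒜.IsHomothetic σ)
    (hτ : 𝒜.IsHomothetic τ) (hp : σ p = τ p) (hq : σ q = τ q)
    (h : ¬ 𝒜.SegParallel p q p r) : σ r = τ r := by
  have h1 := hσ p r
  have h2 := hσ q r
  have h3 := hτ p r
  have h4 := hτ q r
  rw [← hp] at h3
  rw [← hq] at h4
  refine SegParallel.inter_unique ?_ h1 h3 h2 h4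
  simp only [segParallel_iff] at *
  grind -ext [direction_comm, direction_join]

/-- A homothetic map is determined by the images of two points. -/
theorem IsHomothetic.ext {σ τ : P → P} (hσ : 𝒜.IsHomothetic σ) (hτ : 𝒜.IsHomothetic τ)
    (h : p ≠ q) (hp : σ p = τ p) (hq : σ q = τ q) : σ = τ := by
  obtain ⟨r, hr⟩ := 𝒜.exists_not_collinear p q h
  have h1 := hσ.eq_of_eq_of_not_collinear hτ hp hq hr
  funext s
  by_cases hs : 𝒜.SegParallel p q p s
  · by_cases hsp : s = p
    · rw [hsp, hp]
    -- A point `s ≠ p` of the line `p q` is off the line `p r`, and the images of `p` and `r` are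
    -- already known to agree.
    refine hσ.eq_of_eq_of_not_collinear hτ hp h1 ?_
    simp only [segParallel_iff] at *
    grind -ext [direction_comm, direction_join]
  · exact hσ.eq_of_eq_of_not_collinear hτ hp hq hs

theorem IsHomothetic.eq_id {σ : P → P} (hσ : 𝒜.IsHomothetic σ) (h : p ≠ q) (hp : σ p = p)
    (hq : σ q = q) : σ = id :=
  hσ.ext isHomothetic_id h hp hq

/-- A homothetic map that is the identity or has no fixed points. -/
def IsShift (𝒜 : AffinePlane P) (τ : P → P) : Prop :=
  𝒜.IsHomothetic τ ∧ (τ = id ∨ ∀ p, τ p ≠ p)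

theorem isShift_id : 𝒜.IsShift id := ⟨isHomothetic_id, Or.inl rfl⟩

theorem IsShift.eq_id {τ : P → P} (h : 𝒜.IsShift τ) (hp : τ p = p) : τ = id :=
  h.2.resolve_right fun H => H p hp

theorem IsHomothetic.segParallel_of_mem_trace {τ : P → P} (h : 𝒜.IsHomothetic τ)
    (hx : 𝒜.SegParallel p (τ p) p x) : 𝒜.SegParallel p (τ p) x (τ x) := by
  by_cases hxp : p = x
  · subst hxp
    simp [segParallel_iff]
  have h1 := h p x
  generalize τ p = p' at *
  generalize τ x = x' at *
  simp only [segParallel_iff] at *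
  grind -ext [direction_comm, direction_join]

/-- Two non-parallel traces would meet in a point `x`, and the trace of `x` would be parallel to
both. -/
theorem IsShift.segParallel {τ : P → P} (h : 𝒜.IsShift τ) (p q : P) :
    𝒜.SegParallel p (τ p) q (τ q) := by
  rcases h.2 with rfl | hf
  · exact segParallel_self_left _ _ _
  by_contra hn
  obtain ⟨x, h1, h2⟩ := exists_segParallel_inter hn p q
  exact hn ((h.1.segParallel_of_mem_trace h1).trans (h.1.segParallel_of_mem_trace h2).symm
    (hf x).symm)

/-- A shift is determined by the image of one point. -/
theorem IsShift.ext {σ τ : P → P} (hσ : 𝒜.IsShift σ) (hτ : 𝒜.IsShift τ) (h : σ p = τ p) :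
    σ = τ := by
  by_cases hp : σ p = p
  · rw [hσ.eq_id hp, hτ.eq_id (h ▸ hp)]
  obtain ⟨r, hr⟩ := 𝒜.exists_not_collinear p (σ p) (Ne.symm hp)
  have hpr : p ≠ r := by
    rintro rfl
    exact hr (by simp [segParallel_iff])
  refine hσ.1.ext hτ.1 hpr h ?_
  refine SegParallel.inter_unique hr (hσ.segParallel p r) (h ▸ hτ.segParallel p r)
    (hσ.1 p r) (h ▸ hτ.1 p r)

/-- If the composite fixes `p`, then `σ` takes `τ p` back to `p`, so both maps have parallel traces.
For `r` off the trace of `p`, the image of `r` lies on the line `p r` and on the parallel to the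
trace through `r`; hence `r` is fixed too. -/
theorem IsShift.comp {σ τ : P → P} (hσ : 𝒜.IsShift σ) (hτ : 𝒜.IsShift τ) :
    𝒜.IsShift (σ ∘ τ) := by
  refine ⟨hσ.1.comp hτ.1, ?_⟩
  by_contra! H
  obtain ⟨hne, p, hp⟩ := H
  apply hne
  simp only [Function.comp_apply] at hp
  by_cases h : τ p = p
  · have := hτ.eq_id h
    subst this
    exact hσ.eq_id hp
  obtain ⟨r, hr⟩ := 𝒜.exists_not_collinear p (τ p) (Ne.symm h)
  have hpr : p ≠ r := by
    rintro rfl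
    exact hr (by simp [segParallel_iff])
  refine (hσ.1.comp hτ.1).eq_id hpr hp ?_
  have h1 := hτ.1 p r
  have h2 := hτ.segParallel p r
  have h3 := hσ.1 (τ p) (τ r)
  have h4 := hσ.segParallel (τ p) (τ r)
  rw [hp] at h3 h4
  simp only [Function.comp_apply]
  generalize τ p = q at *
  generalize τ r = s at *
  generalize σ s = t at *
  have h5 : 𝒜.SegParallel p r p t := by
    refine h1.trans h3 ?_
    rintro rfl
    simp only [segParallel_iff] at *
    grind -ext [direction_comm, direction_join]
  refine SegParallel.inter_unique (b := p) hr (a := s) ?_ ?_ h5 ?_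
  all_goals
    simp only [segParallel_iff] at *
    grind -ext [direction_comm]

/-- Shifts with non-parallel traces commute. -/
theorem IsShift.comm_of_not_segParallel {σ τ : P → P} (hσ : 𝒜.IsShift σ) (hτ : 𝒜.IsShift τ)
    (h : ¬ 𝒜.SegParallel p (σ p) p (τ p)) : σ ∘ τ = τ ∘ σ := by
  refine (hσ.comp hτ).ext (hτ.comp hσ) (p := p) ?_
  -- Both images of `p` complete the parallelogram on `p`, `σ p`, `τ p`.
  exact SegParallel.inter_unique h (hσ.segParallel p (τ p)) (hτ.1 p (σ p))
    (hσ.1 p (τ p)) (hτ.segParallel p (σ p))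

/-! ### Maps from Desarguesian pencils, parallel and central alike -/

/-- The lines of a pencil, given as the classes of an equivalence relation on a type `Q` of points,
with Desargues' axiom for triangles whose vertices are joined by lines of the pencil. -/
structure IsDesarguesianPencil (𝒜 : AffinePlane P) {Q : Type*} (ι : Q → P)
    (E : Setoid Q) : Prop where
  segParallel : ∀ x y z w : Q, E x y → E x z → E x w → 𝒜.SegParallel (ι x) (ι y) (ι z) (ι w)
  exists_inter : ∀ p q r : Q, ¬ E p r → E p q →
    ∃ r', E r r' ∧ 𝒜.SegParallel (ι p) (ι r) (ι q) (ι r')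
  inter_unique : ∀ p q r r₁ r₂ : Q, ¬ E p r → E p q → E r r₁ → E r r₂ →
    𝒜.SegParallel (ι p) (ι r) (ι q) (ι r₁) → 𝒜.SegParallel (ι p) (ι r) (ι q) (ι r₂) → r₁ = r₂
  ne : ∀ p q r r' : Q, ¬ E p r → E p q → E r r' →
    𝒜.SegParallel (ι p) (ι r) (ι q) (ι r') → p ≠ q → r ≠ r'
  desargues : ∀ a b c a' b' c' : Q, a ≠ a' → b ≠ b' → c ≠ c' → ¬ E a b → ¬ E b c → ¬ E a c →
    E a a' → E b b' → E c c' → 𝒜.SegParallel (ι a) (ι b) (ι a') (ι b') →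
    𝒜.SegParallel (ι b) (ι c) (ι b') (ι c') → 𝒜.SegParallel (ι a) (ι c) (ι a') (ι c')
  -- The second alternative is for the plane of order two, where a parallel class has only two
  -- lines.
  exists_third : ∀ p x : Q, ¬ E p x → (∃ y, ¬ E p y ∧ ¬ E x y) ∨
    ∀ r r' s s' : Q, E p r → E p r' → E x s → E x s' → r ≠ r' → s ≠ s' →
      𝒜.SegParallel (ι r) (ι s) (ι r') (ι s')
  exists_off : ∀ p : Q, ∃ x, ¬ E p x

/-- A pencil has a homothetic map that maps every line of the pencil into itself and maps a given
point to a given other point of the same line. -/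
theorem IsDesarguesianPencil.exists_map {Q : Type*} {ι : Q → P} {E : Setoid Q}
    (h : 𝒜.IsDesarguesianPencil ι E) {p q : Q} (hpq : E p q) (hne : p ≠ q) :
    ∃ σ : Q → Q, σ p = q ∧ (∀ r, E r (σ r) ∧ r ≠ σ r) ∧
      ∀ r s, 𝒜.SegParallel (ι r) (ι s) (ι (σ r)) (ι (σ s)) := by
  have key : ∀ p q r r' s s' : Q, E p q → p ≠ q → ¬ E p r → ¬ E p s → ¬ E r s → E r r' → E s s' →
      𝒜.SegParallel (ι p) (ι r) (ι q) (ι r') → 𝒜.SegParallel (ι p) (ι s) (ι q) (ι s') →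
      𝒜.SegParallel (ι r) (ι s) (ι r') (ι s') := by
    intro p q r r' s s' hpq hne hr hs hrs hr' hs' h1 h2
    refine h.desargues r p s r' q s' (h.ne _ _ _ _ hr hpq hr' h1 hne) hne
      (h.ne _ _ _ _ hs hpq hs' h2 hne) (fun e => hr (E.symm e)) hs hrs hr' hpq hs' ?_ h2
    simp only [segParallel_iff] at *
    grind -ext [direction_comm]
  have swap : ∀ {a b c d : P}, 𝒜.SegParallel a b c d → 𝒜.SegParallel b a d c := by
    intro a b c d H
    simp only [segParallel_iff] at *
    grind -ext [direction_comm]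
  -- Off the pencil line of `p`, the parallel to `p r` through `q` gives the image; on that line,
  -- the construction is repeated from an auxiliary pair `x`, `x'`.
  let H : Q → Q → Prop := fun r r' => E r r' ∧ r ≠ r' ∧
    ((¬ E p r ∧ 𝒜.SegParallel (ι p) (ι r) (ι q) (ι r')) ∨
      (E p r ∧ ∃ x x', ¬ E p x ∧ E x x' ∧ x ≠ x' ∧ 𝒜.SegParallel (ι p) (ι x) (ι q) (ι x') ∧
        𝒜.SegParallel (ι x) (ι r) (ι x') (ι r')))
  have hex : ∀ r, ∃ r', H r r' := by
    intro r
    by_cases hr : E p r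
    · obtain ⟨x, hx⟩ := h.exists_off p
      obtain ⟨x', hx', h1⟩ := h.exists_inter p q x hx hpq
      have hxr : ¬ E x r := fun e => hx (E.trans hr (E.symm e))
      obtain ⟨r', hr', h2⟩ := h.exists_inter x x' r hxr hx'
      have hxx := h.ne _ _ _ _ hx hpq hx' h1 hne
      exact ⟨r', hr', h.ne _ _ _ _ hxr hx' hr' h2 hxx, Or.inr ⟨hr, x, x', hx, hx', hxx, h1, h2⟩⟩
    · obtain ⟨r', hr', h1⟩ := h.exists_inter p q r hr hpq
      exact ⟨r', hr', h.ne _ _ _ _ hr hpq hr' h1 hne, Or.inl ⟨hr, h1⟩⟩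
  have hmixed : ∀ r r' s s', H r r' → H s s' → E p r → ¬ E p s →
      𝒜.SegParallel (ι r) (ι s) (ι r') (ι s') := by
    rintro r r' s s' ⟨hr, hrr, hr1⟩ ⟨hs, hss, hs1⟩ hpr hps
    obtain ⟨-, x, x', hx, hx', hxx, h1, h2⟩ := hr1.resolve_left fun e => e.1 hpr
    have h3 := (hs1.resolve_right fun e => hps e.1).2
    have hrs : ¬ E r s := fun e => hps (E.trans hpr e)
    have hxr : ¬ E x r := fun e => hx (E.trans hpr (E.symm e))
    by_cases hxs : E x s
    · rcases h.exists_third p x hx with ⟨y, hpy, hxy⟩ | H'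
      · obtain ⟨y', hy', h4⟩ := h.exists_inter p q y hpy hpq
        have h5 := key p q x x' y y' hpq hne hx hpy hxy hx' hy' h1 h4
        have hry : ¬ E r y := fun e => hpy (E.trans hpr e)
        have hys : ¬ E y s := fun e => hxy (E.trans hxs (E.symm e))
        have h6 := key x x' r r' y y' hx' hxx hxr hxy hry hr hy' h2 h5
        have h7 := key p q y y' s s' hpq hne hpy hps hys hy' hs h4 h3
        exact key y y' r r' s s' hy' (h.ne _ _ _ _ hpy hpq hy' h4 hne) (fun e => hry (E.symm e))
          hys hrs hr hs (swap h6) h7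
      · exact H' r r' s s' hpr (E.trans hpr hr) hxs (E.trans hxs hs) hrr hss
    · have h4 := key p q x x' s s' hpq hne hx hps hxs hx' hs h1 h3
      exact key x x' r r' s s' hx' hxx hxr hxs hrs hr hs h2 h4
  choose σ hσ using hex
  refine ⟨σ, ?_, fun r => ⟨(hσ r).1, (hσ r).2.1⟩, ?_⟩
  · obtain ⟨x, hx⟩ := h.exists_off p
    have h1 := hmixed p (σ p) x (σ x) (hσ p) (hσ x) (E.refl p) hx
    have h2 : 𝒜.SegParallel (ι p) (ι x) (ι q) (ι (σ x)) :=
      ((hσ x).2.2.resolve_right fun e => hx e.1).2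
    exact h.inter_unique x (σ x) p _ _ (fun e => hx (E.symm e)) (hσ x).1 (hσ p).1 hpq
      (swap h1) (swap h2)
  · intro r s
    by_cases hrs : E r s
    · exact h.segParallel r s (σ r) (σ s) hrs (hσ r).1 (E.trans hrs (hσ s).1)
    by_cases hr : E p r
    · exact hmixed _ _ _ _ (hσ r) (hσ s) hr fun e => hrs (E.trans (E.symm hr) e)
    by_cases hs : E p s
    · exact swap (hmixed _ _ _ _ (hσ s) (hσ r) hs hr)
    · exact key p q r (σ r) s (σ s) hpq hne hr hs hrs (hσ r).1 (hσ s).1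
        ((hσ r).2.2.resolve_right fun e => hr e.1).2 ((hσ s).2.2.resolve_right fun e => hs e.1).2

/-- The pencil of the lines parallel to the line joining two points. -/
def parallelSetoid (𝒜 : AffinePlane P) (o e : P) (h : o ≠ e) : Setoid P where
  r x y := 𝒜.SegParallel o e x y
  iseqv := by
    constructor
    all_goals
      simp only [segParallel_iff]
      grind -ext [direction_comm, direction_join]

theorem parallelSetoid_iff {o e : P} {h : o ≠ e} :
    𝒜.parallelSetoid o e h x y ↔ 𝒜.SegParallel o e x y := Iff.rfl

/-- The pencil of the lines through a point. -/
def centralSetoid (𝒜 : AffinePlane P) (o : P) : Setoid {x // x ≠ o} where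
  r x y := 𝒜.SegParallel o x o y
  iseqv := by
    constructor
    all_goals
      simp only [segParallel_iff]
      grind -ext [direction_comm, direction_join]

theorem centralSetoid_iff {o : P} {x y : {x // x ≠ o}} :
    𝒜.centralSetoid o x y ↔ 𝒜.SegParallel o x o y := Iff.rfl

theorem isDesarguesianPencil_parallelSetoid (h𝒜 : 𝒜.IsDesarguesian) (o e : P) (h : o ≠ e) :
    𝒜.IsDesarguesianPencil id (𝒜.parallelSetoid o e h) where
  segParallel x y z w h1 h2 h3 := by
    simp only [parallelSetoid_iff, segParallel_iff, id] at *
    grind -ext [direction_comm, direction_join]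
  exists_inter p q r hr hq := by
    simp only [parallelSetoid_iff, id] at *
    refine exists_segParallel_inter (fun hn => hr ?_) r q
    simp only [segParallel_iff] at *
    grind -ext [direction_comm, direction_join]
  inter_unique p q r r₁ r₂ hr hq h1 h2 h3 h4 := by
    simp only [parallelSetoid_iff, id] at *
    refine SegParallel.inter_unique (fun hn => hr ?_) h1 h2 h3 h4
    simp only [segParallel_iff] at *
    grind -ext [direction_comm, direction_join]
  ne p q r r' hr hq hr' h1 hpq := by
    rintro rfl
    simp only [parallelSetoid_iff, segParallel_iff, id] at *
    grind -ext [direction_comm, direction_join]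
  desargues a b c a' b' c' ha hb hc hab hbc hac haa hbb hcc h1 h2 := by
    simp only [parallelSetoid_iff, id] at *
    refine h𝒜.segParallel ha hb hc ?_ ?_ ?_ ?_ ?_ ?_ ?_ ?_ ?_ (Or.inl ⟨?_, ?_, ?_⟩) h1 h2
    all_goals
      clear h𝒜
      try rw [mem_line_iff (by assumption)]
      simp only [segParallel_iff] at *
      grind -ext [direction_comm, direction_join]
  exists_third p x hpx := by
    simp only [parallelSetoid_iff, id] at *
    refine or_iff_not_imp_left.2 fun H r r' s s' hr hr' hs hs' hrr hss => ?_
    push Not at H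
    -- With no third line, a common point of `r s` and `r' s'` lies on one of the two pencil lines,
    -- forcing `r = r'` or `s = s'`.
    by_contra hn
    obtain ⟨y, h1, h2⟩ := exists_segParallel_inter hn r r'
    have key : ∀ {r s}, 𝒜.SegParallel o e p r → 𝒜.SegParallel o e x s → 𝒜.SegParallel r s r y →
        (𝒜.SegParallel o e p y → r = y) ∧ (𝒜.SegParallel o e x y → s = y) := by
      clear hn h1 h2 H hr hr' hs hs'
      intro r s hr hs h1
      have hrs : ¬ 𝒜.SegParallel o e r s := by
        clear h1
        simp only [segParallel_iff] at *
        grind -ext [direction_comm, direction_join]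
      exact ⟨fun h3 => SegParallel.inter_unique hrs hr h3 (by simp [segParallel_iff]) h1,
        fun h3 => SegParallel.inter_unique hrs hs h3 (by simp [segParallel_iff]) h1⟩
    by_cases hy : 𝒜.SegParallel o e p y
    · exact hrr (((key hr hs h1).1 hy).trans ((key hr' hs' h2).1 hy).symm)
    · exact hss (((key hr hs h1).2 (H y hy)).trans ((key hr' hs' h2).2 (H y hy)).symm)
  exists_off p := by
    simp only [parallelSetoid_iff] at *
    obtain ⟨x, hx⟩ := 𝒜.exists_not_collinear o e h
    by_contra! H
    have h1 := H o
    have h2 := H x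
    simp only [segParallel_iff] at *
    grind -ext [direction_comm, direction_join]

theorem isDesarguesianPencil_centralSetoid (h𝒜 : 𝒜.IsDesarguesian) (o : P) :
    𝒜.IsDesarguesianPencil Subtype.val (𝒜.centralSetoid o) where
  segParallel := by
    rintro ⟨x, hx⟩ ⟨y, hy⟩ ⟨z, hz⟩ ⟨w, hw⟩ h1 h2 h3
    simp only [centralSetoid_iff, segParallel_iff] at *
    grind -ext [direction_comm, direction_join]
  exists_inter := by
    rintro ⟨p, hp⟩ ⟨q, hq⟩ ⟨r, hr⟩ h1 h2
    simp only [centralSetoid_iff] at *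
    have h3 : ¬ 𝒜.SegParallel o r p r := by
      simp only [segParallel_iff] at *
      grind -ext [direction_comm, direction_join]
    obtain ⟨x, h4, h5⟩ := exists_segParallel_inter h3 o q
    refine ⟨⟨x, ?_⟩, h4, h5⟩
    rintro rfl
    simp only [segParallel_iff] at *
    grind -ext [direction_comm, direction_join]
  inter_unique := by
    rintro ⟨p, hp⟩ ⟨q, hq⟩ ⟨r, hr⟩ ⟨r₁, hr₁⟩ ⟨r₂, hr₂⟩ h1 h2 h3 h4 h5 h6
    simp only [centralSetoid_iff, Subtype.mk.injEq] at *
    refine SegParallel.inter_unique (fun hn => h1 ?_) h3 h4 h5 h6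
    simp only [segParallel_iff] at *
    grind -ext [direction_comm, direction_join]
  ne := by
    rintro ⟨p, hp⟩ ⟨q, hq⟩ ⟨r, hr⟩ ⟨r', hr'⟩ h1 h2 h3 h4 h5 h6
    simp only [centralSetoid_iff, segParallel_iff, ne_eq, Subtype.mk.injEq] at *
    subst h6
    grind -ext [direction_comm, direction_join]
  desargues := by
    rintro ⟨a, ha⟩ ⟨b, hb⟩ ⟨c, hc⟩ ⟨a', ha'⟩ ⟨b', hb'⟩ ⟨c', hc'⟩ haa hbb hcc hab hbc hac
      haa' hbb' hcc' h1 h2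
    simp only [centralSetoid_iff, ne_eq, Subtype.mk.injEq] at *
    refine h𝒜.segParallel haa hbb hcc ?_ ?_ ?_ ?_ ?_ ?_ ?_ ?_ ?_ (Or.inr ⟨o, ?_, ?_, ?_⟩) h1 h2
    all_goals
      clear h𝒜
      try rw [mem_line_iff (by assumption)]
      simp only [segParallel_iff] at *
      clear h1 h2
      grind -ext [direction_comm, direction_join]
  exists_third := by
    rintro ⟨p, hp⟩ ⟨x, hx⟩ h1
    left
    simp only [centralSetoid_iff] at *
    -- The diagonal of the parallelogram on `o`, `p`, `x` is a third line through `o`.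
    obtain ⟨y, h2, h3⟩ := exists_segParallel_inter h1 x p
    have hy : y ≠ o := by
      rintro rfl
      simp only [segParallel_iff] at *
      grind -ext [direction_comm, direction_join]
    refine ⟨⟨y, hy⟩, ?_, ?_⟩
    all_goals
      simp only [segParallel_iff] at *
      grind -ext [direction_comm, direction_join]
  exists_off := by
    rintro ⟨p, hp⟩
    obtain ⟨x, hx⟩ := 𝒜.exists_not_collinear o p hp.symm
    refine ⟨⟨x, ?_⟩, hx⟩
    rintro rfl
    simp [segParallel_iff] at hx

/-! ### Existence and commutation of shifts and homothetic maps -/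

theorem IsDesarguesian.exists_isShift (h𝒜 : 𝒜.IsDesarguesian) (p q : P) :
    ∃ τ, 𝒜.IsShift τ ∧ τ p = q := by
  by_cases h : p = q
  · exact ⟨id, isShift_id, h⟩
  obtain ⟨σ, h1, h2, h3⟩ := (isDesarguesianPencil_parallelSetoid h𝒜 p q h).exists_map
    (p := p) (q := q) (by simp [parallelSetoid_iff, segParallel_iff]) h
  exact ⟨σ, ⟨h3, Or.inr fun r => (h2 r).2.symm⟩, h1⟩

theorem IsDesarguesian.exists_isHomothetic (h𝒜 : 𝒜.IsDesarguesian) {o e a : P} (h : o ≠ e)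
    (ha : 𝒜.SegParallel o e o a) : ∃ δ, 𝒜.IsHomothetic δ ∧ δ o = o ∧ δ e = a := by
  classical
  by_cases hoa : a = o
  · exact ⟨fun _ => o, isHomothetic_const o, rfl, hoa.symm⟩
  by_cases hea : e = a
  · exact ⟨id, isHomothetic_id, rfl, hea⟩
  obtain ⟨σ, h1, h2, h3⟩ := (isDesarguesianPencil_centralSetoid h𝒜 o).exists_map
    (p := ⟨e, h.symm⟩) (q := ⟨a, hoa⟩) ha (by simpa using hea)
  refine ⟨fun x => if hx : x = o then o else σ ⟨x, hx⟩, ?_, by simp, by simp [h.symm, h1]⟩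
  intro x y
  by_cases hx : x = o <;> by_cases hy : y = o
  · simp [segParallel_iff, hx, hy]
  · subst hx
    simpa [hy] using centralSetoid_iff.1 (h2 ⟨y, hy⟩).1
  · subst hy
    have := centralSetoid_iff.1 (h2 ⟨x, hx⟩).1
    simp only [hx, dif_pos, dif_neg, not_false_eq_true]
    simp only [segParallel_iff] at *
    grind -ext [direction_comm]
  · simpa [hx, hy] using h3 ⟨x, hx⟩ ⟨y, hy⟩

/-- For parallel traces, take a shift `ρ` in another direction. Then `σ` commutes with `ρ` and with
`τ ∘ ρ`, hence with `τ`. -/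
theorem IsShift.comm (h𝒜 : 𝒜.IsDesarguesian) {σ τ : P → P} (hσ : 𝒜.IsShift σ)
    (hτ : 𝒜.IsShift τ) : σ ∘ τ = τ ∘ σ := by
  rcases hσ.2 with rfl | hσf
  · rfl
  rcases hτ.2 with rfl | hτf
  · rfl
  obtain ⟨p, -⟩ := 𝒜.exists_noncollinear
  by_cases h : 𝒜.SegParallel p (σ p) p (τ p)
  · obtain ⟨r, hr⟩ := 𝒜.exists_not_collinear p (σ p) (hσf p).symm
    obtain ⟨ρ, hρ, rfl⟩ := h𝒜.exists_isShift p r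
    have h1 : σ ∘ ρ = ρ ∘ σ := hσ.comm_of_not_segParallel hρ hr
    have h2 : σ ∘ (τ ∘ ρ) = (τ ∘ ρ) ∘ σ := by
      refine hσ.comm_of_not_segParallel (hτ.comp hρ) (p := p) ?_
      have h3 := hτ.segParallel p (ρ p)
      have h4 := hσf p
      have h5 := hτf p
      have h6 := hτf (ρ p)
      simp only [Function.comp_apply]
      intro h7
      have h8 : 𝒜.SegParallel p (σ p) (ρ p) (τ (ρ p)) := h.trans h3 h5.symm
      clear h3 h1 hσ hτ hρ hσf hτf h𝒜
      simp only [segParallel_iff] at *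
      grind -ext [direction_comm, direction_join]
    refine (hσ.comp hτ).ext (hτ.comp hσ) (p := ρ p) ?_
    have e1 := congrFun h1 p
    have e2 := congrFun h2 p
    simp only [Function.comp_apply] at *
    rw [e2, e1]
  · exact hσ.comm_of_not_segParallel hτ h

theorem IsHomothetic.eq_const {δ : P → P} (hδ : 𝒜.IsHomothetic δ) (h : p ≠ q) (hpq : δ p = δ q) :
    δ = fun _ => δ p :=
  hδ.ext (isHomothetic_const _) h rfl hpq.symm

/-- If `δ` identifies two points it is constant, and then `τ'` has a fixed point. Otherwise
parallels determine the common value at a point `r` off the trace of `p`, and two values suffice. -/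
theorem IsHomothetic.comp_isShift {δ τ τ' : P → P} (hδ : 𝒜.IsHomothetic δ) (hτ : 𝒜.IsShift τ)
    (hτ' : 𝒜.IsShift τ') (h : δ (τ p) = τ' (δ p)) : δ ∘ τ = τ' ∘ δ := by
  rcases hτ.2 with rfl | hτf
  · rw [hτ'.eq_id h.symm]
    rfl
  have hconst : ∀ q, p ≠ q → δ p = δ q → δ ∘ τ = τ' ∘ δ := by
    intro q hq hpq
    have hc : ∀ x, δ x = δ p := congrFun (hδ.eq_const hq hpq)
    rw [hc] at h
    rw [hτ'.eq_id h.symm]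
    funext x
    simp [hc]
  by_cases hp' : δ p = τ' (δ p)
  · exact hconst (τ p) (hτf p).symm (hp'.trans h.symm)
  obtain ⟨r, hr⟩ := 𝒜.exists_not_collinear p (τ p) (hτf p).symm
  have hpr : p ≠ r := by
    rintro rfl
    exact hr (by simp [segParallel_iff])
  by_cases hr' : δ p = δ r
  · exact hconst r hpr hr'
  refine (hδ.comp hτ.1).ext (hτ'.1.comp hδ) hpr h ?_
  have h1 := hτ.segParallel p r
  have h2 := hτ.1 p r
  refine SegParallel.inter_unique hr (a := δ r) (b := δ (τ p)) ?_ ?_ ?_ ?_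
  · exact h1.trans (hδ r (τ r)) (hτf r).symm
  · refine SegParallel.trans ?_ (hτ'.segParallel (δ p) (δ r)) hp'
    rw [← h]
    exact hδ _ _
  · refine h2.trans (hδ (τ p) (τ r)) ?_
    intro e
    rw [← e] at h1
    have := hτf p
    clear hconst hδ hτ hτ' hτf h2
    simp only [segParallel_iff] at *
    grind -ext [direction_comm, direction_join]
  · rw [h]
    exact (hδ p r).trans (hτ'.1 _ _) hr'

/-! ### The skew field of a line -/

/-- The shift that maps `o` to `a`. -/
noncomputable def IsDesarguesian.shift (h𝒜 : 𝒜.IsDesarguesian) (o a : P) : P → P :=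
  (h𝒜.exists_isShift o a).choose

theorem IsDesarguesian.isShift_shift (h𝒜 : 𝒜.IsDesarguesian) (o a : P) :
    𝒜.IsShift (h𝒜.shift o a) :=
  (h𝒜.exists_isShift o a).choose_spec.1

@[simp]
theorem IsDesarguesian.shift_base (h𝒜 : 𝒜.IsDesarguesian) (o a : P) : h𝒜.shift o a o = a :=
  (h𝒜.exists_isShift o a).choose_spec.2

theorem IsDesarguesian.shift_self (h𝒜 : 𝒜.IsDesarguesian) (o : P) : h𝒜.shift o o = id :=
  (h𝒜.isShift_shift o o).eq_id (h𝒜.shift_base o o)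

theorem IsDesarguesian.shift_comp (h𝒜 : 𝒜.IsDesarguesian) (o a b : P) :
    h𝒜.shift o (h𝒜.shift o a b) = h𝒜.shift o a ∘ h𝒜.shift o b :=
  (h𝒜.isShift_shift _ _).ext ((h𝒜.isShift_shift _ _).comp (h𝒜.isShift_shift _ _)) (p := o)
    (by simp)

theorem IsDesarguesian.shift_comm (h𝒜 : 𝒜.IsDesarguesian) (o a b : P) :
    h𝒜.shift o a b = h𝒜.shift o b a := by
  have := congrFun ((h𝒜.isShift_shift o a).comm h𝒜 (h𝒜.isShift_shift o b)) o
  simpa using this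

theorem IsDesarguesian.shift_neg (h𝒜 : 𝒜.IsDesarguesian) (o a : P) :
    h𝒜.shift o (h𝒜.shift a o o) a = o := by
  have h : h𝒜.shift o (h𝒜.shift a o o) = h𝒜.shift a o :=
    (h𝒜.isShift_shift _ _).ext (h𝒜.isShift_shift _ _) (p := o) (by simp)
  rw [h, h𝒜.shift_base]

/-- For `δ` fixing `o` this is left distributivity. The base point may move, so that it also yields
additivity of the translation in the main theorem. -/
theorem IsHomothetic.map_shift (h𝒜 : 𝒜.IsDesarguesian) {δ : P → P} (hδ : 𝒜.IsHomothetic δ)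
    (o a b : P) : δ (h𝒜.shift o a b) = h𝒜.shift (δ o) (δ a) (δ b) :=
  congrFun (hδ.comp_isShift (h𝒜.isShift_shift o a) (h𝒜.isShift_shift (δ o) (δ a)) (p := o)
    (by simp)) b

theorem IsDesarguesian.segParallel_shift (h𝒜 : 𝒜.IsDesarguesian) {o a b c : P}
    (ha : 𝒜.SegParallel o c o a) (hb : 𝒜.SegParallel o c o b) :
    𝒜.SegParallel o c o (h𝒜.shift o a b) := by
  by_cases h : o = a
  · simpa [← h, h𝒜.shift_self] using hb
  have h1 := (h𝒜.isShift_shift o a).segParallel o b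
  rw [h𝒜.shift_base] at h1
  generalize h𝒜.shift o a b = d at *
  clear h𝒜
  have h2 := ha.trans h1 h
  simp only [segParallel_iff] at *
  grind -ext [direction_comm, direction_join]

/-- The pointwise sum `F` is additive, and `F z` stays on the line `o z`. Writing `q = p + z`, both
`p q` and the segment of images are then parallel to `o z`, up to degenerate cases. This gives right
distributivity. -/
theorem IsHomothetic.shift (h𝒜 : 𝒜.IsDesarguesian) {δ ε : P → P} {o : P}
    (hδ : 𝒜.IsHomothetic δ) (hε : 𝒜.IsHomothetic ε) (hδo : δ o = o) (hεo : ε o = o) :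
    𝒜.IsHomothetic fun x => h𝒜.shift o (δ x) (ε x) := by
  have hF : ∀ z, 𝒜.SegParallel o z o (h𝒜.shift o (δ z) (ε z)) := fun z =>
    h𝒜.segParallel_shift (by simpa [hδo] using hδ o z) (by simpa [hεo] using hε o z)
  have hadd : ∀ x z, h𝒜.shift o (δ (h𝒜.shift o x z)) (ε (h𝒜.shift o x z)) =
      h𝒜.shift o (h𝒜.shift o (δ x) (ε x)) (h𝒜.shift o (δ z) (ε z)) := by
    intro x z
    rw [hδ.map_shift h𝒜, hε.map_shift h𝒜, hδo, hεo]
    simp only [h𝒜.shift_comp, Function.comp_apply]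
    congr 1
    rw [h𝒜.shift_comm o (δ z), h𝒜.shift_comm o (δ z), h𝒜.shift_comp, Function.comp_apply]
  intro p q
  obtain ⟨z, rfl⟩ : ∃ z, h𝒜.shift o p z = q :=
    ⟨h𝒜.shift o (h𝒜.shift p o o) q, by
      rw [← Function.comp_apply (f := h𝒜.shift o p), ← h𝒜.shift_comp, h𝒜.shift_comm o p,
        h𝒜.shift_neg, h𝒜.shift_self, id]⟩
  simp only [hadd]
  have h1 := (h𝒜.isShift_shift o p).1 o z
  have h2 := (h𝒜.isShift_shift o (h𝒜.shift o (δ p) (ε p))).1 o (h𝒜.shift o (δ z) (ε z))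
  rw [h𝒜.shift_base] at h1 h2
  have h3 := hF z
  by_cases hz : o = z
  · subst hz
    simp only [hδo, hεo, h𝒜.shift_comm _ _ o, h𝒜.shift_self]
    rw [h𝒜.shift_comm]
    simp [segParallel_iff]
  by_cases hz' : o = h𝒜.shift o (δ z) (ε z)
  · rw [← hz', h𝒜.shift_base]
    simp [segParallel_iff]
  exact (h1.symm.trans h3 hz).trans h2 hz'

/-- The homothetic map that fixes `o` and maps `e` to the point `a` of the line `oe`. -/
noncomputable def IsDesarguesian.homothety (h𝒜 : 𝒜.IsDesarguesian) {o e : P} (h : o ≠ e)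
    (a : 𝒜.line o e) : P → P :=
  (h𝒜.exists_isHomothetic h ((mem_line_iff h).1 a.2)).choose

section

variable (h𝒜 : 𝒜.IsDesarguesian) {o e : P} (h : o ≠ e) (a : 𝒜.line o e)

theorem IsDesarguesian.isHomothetic_homothety : 𝒜.IsHomothetic (h𝒜.homothety h a) :=
  (h𝒜.exists_isHomothetic h ((mem_line_iff h).1 a.2)).choose_spec.1

@[simp]
theorem IsDesarguesian.homothety_base : h𝒜.homothety h a o = o :=
  (h𝒜.exists_isHomothetic h ((mem_line_iff h).1 a.2)).choose_spec.2.1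

@[simp]
theorem IsDesarguesian.homothety_unit : h𝒜.homothety h a e = a :=
  (h𝒜.exists_isHomothetic h ((mem_line_iff h).1 a.2)).choose_spec.2.2

theorem IsDesarguesian.homothety_eq {δ : P → P} (hδ : 𝒜.IsHomothetic δ) (ho : δ o = o)
    (he : δ e = a) : h𝒜.homothety h a = δ :=
  (h𝒜.isHomothetic_homothety h a).ext hδ h (by simp [ho]) (by simp [he])

end

theorem IsHomothetic.mem_line {δ : P → P} (hδ : 𝒜.IsHomothetic δ) {o e : P} (h : o ≠ e)
    (ho : δ o = o) (hx : x ∈ 𝒜.line o e) : δ x ∈ 𝒜.line o e := by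
  rw [mem_line_iff h] at *
  by_cases hxo : o = x
  · simp [segParallel_iff, ← hxo, ho]
  · exact hx.trans (by simpa [ho] using hδ o x) hxo

/-- The skew field of a line. -/
@[reducible]
noncomputable def IsDesarguesian.lineDivisionRing (h𝒜 : 𝒜.IsDesarguesian) {o e : P}
    (h : o ≠ e) : DivisionRing (𝒜.line o e) :=
  have hinv : ∀ a : 𝒜.line o e, ∃ b : 𝒜.line o e, (a : P) ≠ o → h𝒜.homothety h a b = e := by
    intro a
    by_cases ha : (a : P) = o
    · exact ⟨a, fun h => absurd ha h⟩
    obtain ⟨δ, h1, h2, h3⟩ := h𝒜.exists_isHomothetic (Ne.symm ha)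
      ((mem_line_iff h).1 a.2).symm
    refine ⟨⟨δ e, h1.mem_line h h2 (𝒜.line_mem h).2.2⟩, fun _ => ?_⟩
    -- Here `δ` takes `a` to `e`, so following it by the homothety of `a` fixes `o` and `a`; thus `δ
    -- e` is a right inverse of `a`.
    have h4 := ((h𝒜.isHomothetic_homothety h a).comp h1).eq_id (p := o) (q := a) (Ne.symm ha)
      (by simp [h2]) (by simp [h3])
    exact congrFun h4 e
  letI : Add (𝒜.line o e) := ⟨fun a b => ⟨h𝒜.shift o a b, (mem_line_iff h).2
    (h𝒜.segParallel_shift ((mem_line_iff h).1 a.2) ((mem_line_iff h).1 b.2))⟩⟩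
  letI : Zero (𝒜.line o e) := ⟨⟨o, (𝒜.line_mem h).2.1⟩⟩
  letI : Neg (𝒜.line o e) := ⟨fun a => ⟨h𝒜.shift a o o, (mem_line_iff h).2 (by
    have h1 := (h𝒜.isShift_shift a o).segParallel a o
    rw [h𝒜.shift_base] at h1
    have h2 := (mem_line_iff h).1 a.2
    by_cases ha : (a : P) = o
    · simp [ha, segParallel_iff]
    · refine SegParallel.trans ?_ h1 ha
      simp only [segParallel_iff] at *
      grind -ext [direction_comm])⟩⟩
  { mul a b := ⟨h𝒜.homothety h a b,
      (h𝒜.isHomothetic_homothety h a).mem_line h (h𝒜.homothety_base h a) b.2⟩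
    one := ⟨e, (𝒜.line_mem h).2.2⟩
    inv a := open Classical in if (a : P) = o then ⟨o, (𝒜.line_mem h).2.1⟩ else (hinv a).choose
    add_assoc a b c := Subtype.ext (congrFun (h𝒜.shift_comp o a b) c)
    add_comm a b := Subtype.ext (h𝒜.shift_comm o a b)
    zero_add a := Subtype.ext (congrFun (h𝒜.shift_self o) a)
    add_zero a := Subtype.ext (h𝒜.shift_base o a)
    neg_add_cancel a := Subtype.ext (h𝒜.shift_neg o a)
    nsmul := nsmulRec
    zsmul := zsmulRec
    mul_assoc a b c := Subtype.ext (congrFun (h𝒜.homothety_eq h _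
      ((h𝒜.isHomothetic_homothety h a).comp (h𝒜.isHomothetic_homothety h b)) (by simp)
      (by simp; rfl)) c)
    one_mul a := Subtype.ext (congrFun (h𝒜.homothety_eq h _ isHomothetic_id rfl rfl) a)
    mul_one a := Subtype.ext (h𝒜.homothety_unit h a)
    zero_mul a := Subtype.ext (congrFun (h𝒜.homothety_eq h _ (isHomothetic_const o) rfl rfl) a)
    mul_zero a := Subtype.ext (h𝒜.homothety_base h a)
    left_distrib a b c := Subtype.ext (by
      have := (h𝒜.isHomothetic_homothety h a).map_shift h𝒜 o b c
      rwa [h𝒜.homothety_base] at this)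
    right_distrib a b c := Subtype.ext (congrFun (h𝒜.homothety_eq h _
      ((h𝒜.isHomothetic_homothety h a).shift h𝒜 (h𝒜.isHomothetic_homothety h b)
        (h𝒜.homothety_base h a) (h𝒜.homothety_base h b)) (by simp)
      (by simp; rfl)) c)
    exists_pair_ne := ⟨⟨o, (𝒜.line_mem h).2.1⟩, ⟨e, (𝒜.line_mem h).2.2⟩, by simpa using h⟩
    mul_inv_cancel a ha := Subtype.ext (by
      have ha' : (a : P) ≠ o := fun e => ha (Subtype.ext e)
      have := (hinv a).choose_spec ha'
      change h𝒜.homothety h a ((@ite _ _ (Classical.propDecidable _) _ _ : 𝒜.line o e) : P) = e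
      rwa [if_neg ha'])
    inv_zero := if_pos rfl
    nnqsmul := _
    nnqsmul_def := fun _ _ => rfl
    qsmul := _
    qsmul_def := fun _ _ => rfl }

/-! ### The geometric algorithms -/

theorem parallelThrough_inter_eq_singleton (h : ¬ 𝒜.SegParallel p q r s)
    (h1 : 𝒜.SegParallel p q a x) (h2 : 𝒜.SegParallel r s b x) :
    𝒜.parallelThrough (𝒜.line p q) a ∩ 𝒜.parallelThrough (𝒜.line r s) b = {x} := by
  have hpq : p ≠ q := fun e => h (segParallel_iff.2 (Or.inl e))
  have hrs : r ≠ s := fun e => h (segParallel_iff.2 (Or.inr (Or.inl e)))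
  ext y
  rw [Set.mem_inter_iff, mem_parallelThrough_iff hpq, mem_parallelThrough_iff hrs,
    Set.mem_singleton_iff]
  constructor
  · exact fun hy => SegParallel.inter_unique h hy.1 h1 hy.2 h2
  · rintro rfl
    exact ⟨h1, h2⟩

theorem parallelThrough_line_self (h : p ≠ q) :
    𝒜.parallelThrough (𝒜.line p q) p = 𝒜.line p q :=
  𝒜.parallelThrough_eq (𝒜.line_mem h).1 (𝒜.line_mem h).1 (𝒜.line_mem h).2.1 (Or.inl rfl)

variable {O I A B C C' B₁ : P}

theorem AddConstruction.unique (h : 𝒜.AddConstruction O I A B B₁ C)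
    (h' : 𝒜.AddConstruction O I A B B₁ C') : C = C' := by
  obtain ⟨P₁, h1, h2⟩ := h
  obtain ⟨P₂, h3, h4⟩ := h'
  obtain rfl := Set.singleton_injective (h1.symm.trans h3)
  exact Set.singleton_injective (h2.symm.trans h4)

theorem MulConstruction.unique (h : 𝒜.MulConstruction O I A B B₁ C)
    (h' : 𝒜.MulConstruction O I A B B₁ C') : C = C' := by
  obtain ⟨P₁, h1, h2⟩ := h
  obtain ⟨P₂, h3, h4⟩ := h'
  obtain rfl := Set.singleton_injective (h1.symm.trans h3)
  exact Set.singleton_injective (h2.symm.trans h4)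

/-- The shift with `O ↦ A` sends `B₁` to `P₁` and the line `B B₁` to its parallel through `P₁`. -/
theorem IsDesarguesian.addConstruction (h𝒜 : 𝒜.IsDesarguesian) (h : O ≠ I)
    (hA : A ∈ 𝒜.line O I) (hB : B ∈ 𝒜.line O I) (hB₁ : B₁ ∉ 𝒜.line O I) :
    𝒜.AddConstruction O I A B B₁ (h𝒜.shift O A B) := by
  rw [mem_line_iff h] at *
  have hτ := h𝒜.isShift_shift O A
  have h1 := hτ.segParallel O B₁
  have h2 := hτ.1 O B₁
  have h3 := h𝒜.segParallel_shift hA hB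
  have h4 := hτ.1 B B₁
  have h5 := hτ.eq_id (p := O)
  rw [h𝒜.shift_base] at h1 h2 h5
  refine ⟨h𝒜.shift O A B₁, parallelThrough_inter_eq_singleton hB₁ ?_ h2, ?_⟩
  · by_cases hAO : A = O
    · simp [h5 hAO, segParallel_iff]
    · exact hA.trans h1 (Ne.symm hAO)
  · rw [← parallelThrough_line_self h]
    refine parallelThrough_inter_eq_singleton ?_ ?_ h3
    · clear h1 h2 h3 h4 h5 hτ hA h𝒜
      simp only [segParallel_iff] at *
      grind -ext [direction_comm, direction_join]
    · simp only [segParallel_iff] at h4 ⊢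
      grind -ext [direction_comm]

/-- The homothety with `I ↦ a` keeps `B₁` on the line `O B₁`, so it sends `B₁` to `P₁`. -/
theorem IsDesarguesian.mulConstruction (h𝒜 : 𝒜.IsDesarguesian) (h : O ≠ I)
    (a : 𝒜.line O I) (hB : B ∈ 𝒜.line O I) (hB₁ : B₁ ∉ 𝒜.line O I) :
    𝒜.MulConstruction O I a B B₁ (h𝒜.homothety h a B) := by
  have hδ := h𝒜.isHomothetic_homothety h a
  have h3 := (mem_line_iff h).1 (hδ.mem_line h (h𝒜.homothety_base h a) hB)
  rw [mem_line_iff h] at *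
  have h1 := hδ I B₁
  have h2 := hδ O B₁
  have h4 := hδ B B₁
  rw [h𝒜.homothety_base] at h2
  rw [h𝒜.homothety_unit] at h1
  have hO : O ≠ B₁ := by
    rintro rfl
    simp [segParallel_iff] at hB₁
  refine ⟨h𝒜.homothety h a B₁, ?_, ?_⟩
  · rw [← parallelThrough_line_self hO]
    refine parallelThrough_inter_eq_singleton ?_ h1 h2
    clear h1 h2 h3 h4 hδ h𝒜
    simp only [segParallel_iff] at *
    grind -ext [direction_comm, direction_join]
  · rw [← parallelThrough_line_self h]
    refine parallelThrough_inter_eq_singleton ?_ ?_ h3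
    · clear h1 h2 h3 h4 hδ h𝒜
      simp only [segParallel_iff] at *
      grind -ext [direction_comm, direction_join]
    · simp only [segParallel_iff] at h4 ⊢
      grind -ext [direction_comm]

theorem exists_notMem_line (h : O ≠ I) : ∃ B₁, B₁ ∉ 𝒜.line O I := by
  simpa only [mem_line_iff h] using 𝒜.exists_not_collinear O I h

theorem IsDesarguesian.isLineSkewField (h𝒜 : 𝒜.IsDesarguesian) (h : O ≠ I) :
    𝒜.IsLineSkewField O I (h𝒜.lineDivisionRing h) :=
  ⟨rfl, rfl, fun A B _ hB₁ =>
    ⟨h𝒜.addConstruction h A.2 B.2 hB₁, h𝒜.mulConstruction h A B.2 hB₁⟩⟩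

/-- A single auxiliary point already determines the sum, so any skew field obeying the algorithms
adds by shifts. -/
theorem IsLineSkewField.coe_add {K : DivisionRing (𝒜.line O I)} (hK : 𝒜.IsLineSkewField O I K)
    (h𝒜 : 𝒜.IsDesarguesian) (h : O ≠ I) (A B : 𝒜.line O I) :
    ((A + B : 𝒜.line O I) : P) = h𝒜.shift O A B := by
  obtain ⟨B₁, hB₁⟩ := exists_notMem_line (𝒜 := 𝒜) h
  exact (hK.2.2 A B B₁ hB₁).1.unique (h𝒜.addConstruction h A.2 B.2 hB₁)

theorem IsLineSkewField.coe_mul {K : DivisionRing (𝒜.line O I)} (hK : 𝒜.IsLineSkewField O I K)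
    (h𝒜 : 𝒜.IsDesarguesian) (h : O ≠ I) (A B : 𝒜.line O I) :
    ((A * B : 𝒜.line O I) : P) = h𝒜.homothety h A B := by
  obtain ⟨B₁, hB₁⟩ := exists_notMem_line (𝒜 := 𝒜) h
  exact (hK.2.2 A B B₁ hB₁).2.unique (h𝒜.mulConstruction h A B.2 hB₁)

/-! ### Transport along a translation -/

theorem IsCollineation.image_line {φ : P → P} (hφ : 𝒜.IsCollineation φ) (h : p ≠ q) :
    φ '' 𝒜.line p q = 𝒜.line (φ p) (φ q) :=
  (𝒜.line_eq (hφ.1.1.ne h) (hφ.2 _ (𝒜.line_mem h).1)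
    (Set.mem_image_of_mem φ (𝒜.line_mem h).2.1) (Set.mem_image_of_mem φ (𝒜.line_mem h).2.2)).symm

theorem IsTranslation.isCollineation {φ : P → P} (hφ : 𝒜.IsTranslation φ) :
    𝒜.IsCollineation φ := by
  rcases hφ with rfl | hφ
  · exact ⟨Function.bijective_id, fun l hl => by simpa using hl⟩
  · exact hφ.1.1

theorem IsTranslation.isHomothetic {φ : P → P} (hφ : 𝒜.IsTranslation φ) :
    𝒜.IsHomothetic φ := by
  have hc := hφ.isCollineation
  rcases hφ with rfl | hφ
  · exact isHomothetic_id
  intro p q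
  by_cases h : p = q
  · simp [segParallel_iff, h]
  have h1 := hφ.1.2 p q h
  rw [hc.image_line h, parallel_line_iff (hc.1.1.ne h) h] at h1
  exact h1.symm

end AffinePlane

/-- Each finite value is an expression in the field operations, and injectivity of `f` makes the
cases with value `∞` correspond. -/
theorem crossRatio_map {K K' : Type*} [DivisionRing K] [DivisionRing K'] (f : K ≃+* K')
    (A B C D : OnePoint K) :
    OnePoint.map f (crossRatio A B C D) =
      crossRatio (OnePoint.map f A) (OnePoint.map f B) (OnePoint.map f C) (OnePoint.map f D) := by
  induction A using OnePoint.rec <;> induction B using OnePoint.rec <;>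
    induction C using OnePoint.rec <;> induction D using OnePoint.rec <;>
    simp only [crossRatio, OnePoint.map_some, OnePoint.map_infty] <;>
    split_ifs <;> simp_all

theorem mainTheorem3 {P : Type*} (𝒜 : AffinePlane P) (h𝒜 : 𝒜.IsDesarguesian)
    (O I : P) (hOI : O ≠ I) (φ : P → P) (hφ : 𝒜.IsTranslation φ) :
    φ '' 𝒜.line O I = 𝒜.line (φ O) (φ I) ∧
    AffinePlane.Parallel (𝒜.line O I) (𝒜.line (φ O) (φ I)) ∧
    (∃ K : DivisionRing (𝒜.line O I), 𝒜.IsLineSkewField O I K) ∧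
    (∃ K' : DivisionRing (𝒜.line (φ O) (φ I)), 𝒜.IsLineSkewField (φ O) (φ I) K') ∧
    ∀ (K : DivisionRing (𝒜.line O I)) (K' : DivisionRing (𝒜.line (φ O) (φ I))),
      𝒜.IsLineSkewField O I K → 𝒜.IsLineSkewField (φ O) (φ I) K' →
      ∃ f : 𝒜.line O I ≃+* 𝒜.line (φ O) (φ I),
        (∀ X : 𝒜.line O I, (f X : P) = φ X) ∧
        ∀ A B C D : OnePoint (𝒜.line O I), CrossRatioDefined A B C D →
          OnePoint.map f (crossRatio A B C D) =
            crossRatio (OnePoint.map f A) (OnePoint.map f B)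
              (OnePoint.map f C) (OnePoint.map f D) := by
  have hc := hφ.isCollineation
  have hh := hφ.isHomothetic
  have hOI' : φ O ≠ φ I := hc.1.1.ne hOI
  have himg := hc.image_line hOI
  refine ⟨himg, (AffinePlane.parallel_line_iff hOI hOI').2 (hh O I),
    ⟨_, h𝒜.isLineSkewField hOI⟩, ⟨_, h𝒜.isLineSkewField hOI'⟩, fun K K' hK hK' => ?_⟩
  let e : 𝒜.line O I ≃ 𝒜.line (φ O) (φ I) :=
    (Equiv.Set.image φ _ hc.1.1).trans (Equiv.setCongr himg)
  have he : ∀ X, (e X : P) = φ X := fun _ => rfl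
  let f : 𝒜.line O I ≃+* 𝒜.line (φ O) (φ I) :=
    { e with
      map_add' := fun A B => Subtype.ext (by
        change (e (A + B) : P) = (e A + e B : 𝒜.line (φ O) (φ I))
        rw [hK'.coe_add h𝒜 hOI', he, he, he, hK.coe_add h𝒜 hOI, hh.map_shift h𝒜])
      map_mul' := fun A B => Subtype.ext (by
        change (e (A * B) : P) = (e A * e B : 𝒜.line (φ O) (φ I))
        rw [hK'.coe_mul h𝒜 hOI', he, he, hK.coe_mul h𝒜 hOI]
        -- Both composites are homothetic, send `O` to `φ O` and `I` to `φ A`, and so coincide.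
        have := (hh.comp (h𝒜.isHomothetic_homothety hOI A)).ext
          ((h𝒜.isHomothetic_homothety hOI' (e A)).comp hh) hOI (by simp) (by simp [he])
        exact congrFun this B) }
  exact ⟨f, he, fun A B C D _ => crossRatio_map f A B C D⟩
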